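/- Let $k$ be a field, $n\ge 0$, $S_n=k[x_1,\dots,x_n]$, and let $f_1,\dots,f_n$ be a regular sequence in $S_n$ consisting of homogeneous polynomials, with $\deg f_i=d_i$. Put $Q=(f_1,\dots,f_n)$. The Hilbert coefficients of an ideal $I$ of $S_n$ are the numbers $e_0(I),\dots,e_n(I)$ such that, for all sufficiently large $s$, the length $l(S_n/I^s)$ of the $S_n$-module $S_n/I^s$ is finite and $$l(S_n/I^s)=\sum_{i=0}^n(-1)^i e_i(I)\binom{s+n-i-1}{n-i}.$$ Then the Hilbert coefficients of $Q$ exist and are uniquely determined, the multiplicity is $e_0(Q)=\prod_{i=1}^n d_i$, and $e_i(Q)=0$ for all $1\le i\le n$. -/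

import Mathlib

/-- `IsHilbertCoefficients I e` says that `e 0, …, e n` are the Hilbert coefficients of the ideal
`I` of `S = k[x_1, …, x_n]`: for all large `s` the `S`-module `S / I ^ s` has finite length, and
this length is `∑_{i=0}^{n} (-1)^i e_i binom(s + n - i - 1, n - i)`.
(For `s ≥ 1` no subtraction below is truncated, so the right-hand side is the value at `s` of the
polynomial in `s` given by the same formula.) -/
def IsHilbertCoefficients {k : Type*} [Field k] {n : ℕ}
    (I : Ideal (MvPolynomial (Fin n) k)) (e : Fin (n + 1) → ℚ) : Prop :=
  ∀ᶠ s : ℕ in Filter.atTop, ∃ l : ℕ,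
    Module.length (MvPolynomial (Fin n) k) (MvPolynomial (Fin n) k ⧸ I ^ s) = (l : ℕ∞) ∧
    (l : ℚ) = ∑ i : Fin (n + 1),
      (-1 : ℚ) ^ (i : ℕ) * e i * ((s + (n - (i : ℕ)) - 1).choose (n - (i : ℕ)) : ℚ)

/-!
Let `S = k[x_1, …, x_n]`, `𝔪 = (x_1, …, x_n)` and `Q = (f_1, …, f_n)`. The lengths come from the
exact sequence `0 → M / (K : r) → M / K → M / (K + r M) → 0`.

For an ideal `I` generated by a regular sequence of length `m`, split off the last element `r`, say
`I = J + (r)`, and take `K = I ^ (s + 2) M = J ^ (s + 2) M + r I ^ (s + 1) M`. Then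
`(K : r) = I ^ (s + 1) M` and `K + r M = J ^ (s + 2) M + r M`, so Pascal's rule filters
`M / I ^ (s + 1) M` by `binom(s + m, m)` copies of `M / I M`. Hence
`l(S / Q ^ (s + 1)) = binom(s + n, n) l(S / Q)`.

For a homogeneous ideal `I` and a form `f` of degree `d` regular on `S / I`, take `K = I + 𝔪 ^ s`.
Then `(K : f) = I + 𝔪 ^ (s - d)`, so passing from `I` to `I + (f)` multiplies the generating
function of `l(S / (I + 𝔪 ^ (s + 1)))` by `1 - X ^ d`. It is `(1 - X) ^ (-(n + 1))`
for `I = 0`, by the first part applied to the regular sequence `x_1, …, x_n`, and therefore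
`∏ (1 + X + ⋯ + X ^ (d_i - 1)) / (1 - X)` for `Q`. The coefficients of the latter are eventually
`∏ d_i`, and `⨅ s, Q + 𝔪 ^ s = Q`, so `l(S / Q) = ∏ d_i`.

Hilbert coefficients are unique because the binomials, as polynomials in `s`, have distinct degrees.
-/

open Pointwise RingTheory.Sequence

universe u v

lemma add_pow_succ_eq {α : Type*} [IdemCommSemiring α] (a b : α) (n : ℕ) :
    (a + b) ^ (n + 1) = a ^ (n + 1) + b * (a + b) ^ n := by
  induction n with
  | zero => simp
  | succ n ih =>
    have absorb : (a + b) ^ n * a + (a + b) ^ (n + 1) = (a + b) ^ (n + 1) := by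
      rw [pow_succ, ← mul_add, ← add_assoc, add_idem]
    calc (a + b) ^ (n + 1 + 1)
        = (a ^ (n + 1) + b * (a + b) ^ n) * a + (a + b) ^ (n + 1) * b := by
          rw [pow_succ _ (n + 1), mul_add, ← ih]
      _ = a ^ (n + 1 + 1) + b * ((a + b) ^ n * a + (a + b) ^ (n + 1)) := by ring
      _ = a ^ (n + 1 + 1) + b * (a + b) ^ (n + 1) := by rw [absorb]

lemma ofList_ofFn {R : Type*} [CommSemiring R] {n : ℕ} (f : Fin n → R) :
    Ideal.ofList (List.ofFn f) = Ideal.span (Set.range f) :=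
  congrArg Ideal.span (Set.ext (List.mem_ofFn' f))

lemma range_lsmul_eq_smul_top {R M : Type*} [CommRing R] [AddCommGroup M] [Module R M] (r : R) :
    (LinearMap.lsmul R M r).range = r • (⊤ : Submodule R M) := by
  rw [LinearMap.range_eq_map]
  rfl

lemma eq_of_le_of_length_quotient_eq {R M : Type*} [Ring R] [AddCommGroup M] [Module R M]
    {K L : Submodule R M} (hKL : K ≤ L) (hlen : Module.length R (M ⧸ K) = Module.length R (M ⧸ L))
    (hfin : Module.length R (M ⧸ L) ≠ ⊤) : K = L := by
  have length_add := Module.length_eq_add_of_exact (Submodule.subtype _) (Submodule.factor hKL)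
    (Submodule.subtype_injective _) (Submodule.factor_surjective hKL)
    (LinearMap.exact_subtype_ker_map _)
  have length_ker : Module.length R (Submodule.factor hKL).ker = 0 :=
    ENat.add_left_injective_of_ne_top hfin <| by
      simp only [zero_add, ← length_add, hlen]
  rw [Module.length_eq_zero_iff, Submodule.subsingleton_iff_eq_bot, Submodule.factor,
    Submodule.ker_mapQ, Submodule.comap_id, ← le_bot_iff, Submodule.map_le_iff_le_comap,
    Submodule.comap_bot, Submodule.ker_mkQ] at length_ker
  exact le_antisymm hKL length_ker

section IteratedExtension

/-- `IsIteratedExtension R M N c` says that `N` has a finite filtration with `c` factors, each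
isomorphic to `M`. It is encoded as the closure of the modules isomorphic to `M` under extensions,
with the numbers of factors adding up. -/
inductive IsIteratedExtension (R : Type u) [CommRing R] (M : Type v) [AddCommGroup M] [Module R M] :
    (N : Type v) → [AddCommGroup N] → [Module R N] → ℕ → Prop
  | of_equiv {N : Type v} [AddCommGroup N] [Module R N] (e : M ≃ₗ[R] N) :
      IsIteratedExtension R M N 1
  | of_exact {N' N N'' : Type v} [AddCommGroup N'] [Module R N'] [AddCommGroup N] [Module R N]
      [AddCommGroup N''] [Module R N''] {a b : ℕ} {f : N' →ₗ[R] N} {g : N →ₗ[R] N''}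
      (hf : Function.Injective f) (hfg : Function.Exact f g) (hg : Function.Surjective g)
      (h' : IsIteratedExtension R M N' a) (h'' : IsIteratedExtension R M N'' b) :
      IsIteratedExtension R M N (a + b)

variable {R : Type u} [CommRing R] {M : Type v} [AddCommGroup M] [Module R M]

namespace IsIteratedExtension

variable {N N' : Type v} [AddCommGroup N] [Module R N] [AddCommGroup N'] [Module R N'] {c : ℕ}

lemma congr_right (h : IsIteratedExtension R M N c) (e : N ≃ₗ[R] N') :
    IsIteratedExtension R M N' c := by
  cases h with
  | of_equiv e' => exact .of_equiv (e'.trans e)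
  | @of_exact _ _ _ _ _ _ _ _ _ _ _ f g hf hfg hg h' h'' =>
    refine .of_exact (f := e ∘ₗ f) (g := g ∘ₗ e.symm) (e.injective.comp hf) ?_
      (hg.comp e.symm.surjective) h' h''
    exact (LinearEquiv.conj_exact_iff_exact f g e).mpr hfg

lemma congr_left {M' : Type v} [AddCommGroup M'] [Module R M'] (h : IsIteratedExtension R M N c)
    (e : M ≃ₗ[R] M') : IsIteratedExtension R M' N c := by
  induction h with
  | of_equiv e' => exact .of_equiv (e.symm.trans e')
  | of_exact hf hfg hg _ _ ih' ih'' => exact .of_exact hf hfg hg ih' ih''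

lemma length_eq (h : IsIteratedExtension R M N c) : Module.length R N = c * Module.length R M := by
  induction h with
  | of_equiv e => rw [e.length_eq, Nat.cast_one, one_mul]
  | of_exact hf hfg hg _ _ ih' ih'' =>
    rw [Module.length_eq_add_of_exact _ _ hf hg hfg, ih', ih'', Nat.cast_add, add_mul]

lemma isSMulRegular {r : R} (h : IsIteratedExtension R M N c) (hr : IsSMulRegular M r) :
    IsSMulRegular N r := by
  induction h with
  | of_equiv e => exact (e.isSMulRegular_congr r).mp hr
  | of_exact hf hfg _ _ _ ih' ih'' =>
    exact isSMulRegular_of_range_eq_ker hf hfg.linearMap_ker_eq.symm ih' ih''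

lemma quotSMulTop {r : R} (h : IsIteratedExtension R M N c) (hr : IsSMulRegular M r) :
    IsIteratedExtension R (QuotSMulTop r M) (QuotSMulTop r N) c := by
  induction h with
  | of_equiv e => exact .of_equiv (QuotSMulTop.congr r e)
  | @of_exact N' _ _ _ _ _ _ _ _ _ _ f g hf hfg hg _ h'' ih' ih'' =>
    have exact_zero : Function.Exact (0 : N' →ₗ[R] N') f :=
      (LinearMap.exact_zero_iff_injective _ f).mpr hf
    have exact_map := QuotSMulTop.map_first_exact_on_four_term_exact_of_isSMulRegular_last
      exact_zero hfg (h''.isSMulRegular hr)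
    have map_zero' : QuotSMulTop.map r (0 : N' →ₗ[R] N') = 0 := map_zero _
    rw [map_zero', LinearMap.exact_zero_iff_injective] at exact_map
    exact .of_exact exact_map (QuotSMulTop.map_exact r hfg hg) (QuotSMulTop.map_surjective r hg)
      ih' ih''

end IsIteratedExtension

/-- The injective map `M / (K : r) → M / K` induced by multiplication by `r`. The colon submodule
`(K : r)` is encoded as the preimage of `K` under multiplication by `r`. -/
def mulQuotientComap (K : Submodule R M) (r : R) :
    M ⧸ K.comap (LinearMap.lsmul R M r) →ₗ[R] M ⧸ K :=
  Submodule.mapQ _ K (LinearMap.lsmul R M r) le_rfl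

lemma mulQuotientComap_injective (K : Submodule R M) (r : R) :
    Function.Injective (mulQuotientComap K r) :=
  LinearMap.ker_eq_bot.mp <| Submodule.ker_liftQ_eq_bot _ _ _ <| by
    rw [LinearMap.ker_comp, Submodule.ker_mkQ]

lemma exact_mulQuotientComap_factor (K : Submodule R M) (r : R) :
    Function.Exact (mulQuotientComap K r)
      (Submodule.factor (le_sup_left : K ≤ K ⊔ r • (⊤ : Submodule R M))) := by
  rw [LinearMap.exact_iff, mulQuotientComap, Submodule.range_mapQ, Submodule.factor,
    Submodule.ker_mapQ, Submodule.comap_id, Submodule.map_sup, Submodule.mkQ_map_self, bot_sup_eq,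
    range_lsmul_eq_smul_top]

lemma length_quotient_eq_length_comap_add_length_sup (K : Submodule R M) (r : R) :
    Module.length R (M ⧸ K) = Module.length R (M ⧸ K.comap (LinearMap.lsmul R M r)) +
      Module.length R (M ⧸ K ⊔ r • (⊤ : Submodule R M)) :=
  Module.length_eq_add_of_exact _ _ (mulQuotientComap_injective K r)
    (Submodule.factor_surjective _) (exact_mulQuotientComap_factor K r)

/-- The isomorphism `(M / K) / r (M / K) ≃ M / (K + r M)`. -/
def quotSMulTopQuotientEquiv (K : Submodule R M) (r : R) :
    QuotSMulTop r (M ⧸ K) ≃ₗ[R] M ⧸ K ⊔ r • (⊤ : Submodule R M) :=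
  Submodule.quotEquivOfEq _ _ (by
    rw [Submodule.map_pointwise_smul, Submodule.map_top, Submodule.range_mkQ]) ≪≫ₗ
  Submodule.quotientQuotientEquivQuotientSup K (r • (⊤ : Submodule R M))

lemma comap_lsmul_sup_smul {K L : Submodule R M} {r : R} (hr : IsSMulRegular (M ⧸ K) r)
    (hKL : K ≤ L) : (K ⊔ r • L).comap (LinearMap.lsmul R M r) = L := by
  refine le_antisymm (fun x hx => ?_)
    fun x hx => Submodule.mem_sup_right (Submodule.smul_mem_pointwise_smul x r L hx)
  obtain ⟨y, hy, z, hz, hyz : y + z = r • x⟩ := Submodule.mem_sup.mp hx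
  obtain ⟨w, hw, rfl⟩ := (Submodule.mem_smul_pointwise_iff_exists z r L).mp hz
  have sub_mem : x - w ∈ K := mem_of_isSMulRegular_quotient_of_smul_mem hr <| by
    rwa [smul_sub, ← hyz, add_sub_cancel_right]
  simpa using L.add_mem (hKL sub_mem) hw

lemma IsIteratedExtension.sup_smul {P : Type v} [AddCommGroup P] [Module R P]
    {K L : Submodule R M} {r : R} {a b : ℕ} (hr : IsSMulRegular (M ⧸ K) r) (hKL : K ≤ L)
    (hL : IsIteratedExtension R P (M ⧸ L) a)
    (hK : IsIteratedExtension R P (M ⧸ K ⊔ r • (⊤ : Submodule R M)) b) :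
    IsIteratedExtension R P (M ⧸ K ⊔ r • L) (a + b) := by
  have sup_eq : K ⊔ r • L ⊔ r • ⊤ = K ⊔ r • (⊤ : Submodule R M) := by
    rw [sup_assoc, ← Submodule.smul_sup', sup_top_eq]
  refine .of_exact (mulQuotientComap_injective (K ⊔ r • L) r) (exact_mulQuotientComap_factor _ r)
    (Submodule.factor_surjective _) ?_ ?_
  · rwa [comap_lsmul_sup_smul hr hKL]
  · rwa [sup_eq]

lemma IsIteratedExtension.quotient_sup_span_singleton_pow {J : Ideal R} {r : R} {n : ℕ}
    (hr : IsSMulRegular (M ⧸ (J • ⊤ : Submodule R M)) r)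
    (hJ : ∀ s, IsIteratedExtension R (M ⧸ (J • ⊤ : Submodule R M))
      (M ⧸ (J ^ (s + 1) • ⊤ : Submodule R M)) ((s + n).choose n)) (s : ℕ) :
    IsIteratedExtension R (M ⧸ ((J ⊔ Ideal.span {r}) • ⊤ : Submodule R M))
      (M ⧸ ((J ⊔ Ideal.span {r}) ^ (s + 1) • ⊤ : Submodule R M))
      ((s + (n + 1)).choose (n + 1)) := by
  have quotient_sup_smul_top (t : ℕ) : IsIteratedExtension R
      (M ⧸ ((J ⊔ Ideal.span {r}) • ⊤ : Submodule R M))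
      (M ⧸ (J ^ (t + 1) • ⊤ : Submodule R M) ⊔ r • (⊤ : Submodule R M)) ((t + n).choose n) := by
    rw [Submodule.sup_smul, Submodule.ideal_span_singleton_smul]
    exact (((hJ t).quotSMulTop hr).congr_right (quotSMulTopQuotientEquiv _ r)).congr_left
      (quotSMulTopQuotientEquiv _ r)
  induction s with
  | zero =>
    rw [zero_add, pow_one, zero_add, Nat.choose_self]
    exact .of_equiv (LinearEquiv.refl R _)
  | succ s ih =>
    have pow_le : J ^ (s + 2) ≤ (J ⊔ Ideal.span {r}) ^ (s + 1) :=
      (Ideal.pow_le_pow_right (Nat.le_succ _)).trans (Ideal.pow_right_mono le_sup_left _)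
    have pow_succ_smul_top : ((J ⊔ Ideal.span {r}) ^ (s + 2) • ⊤ : Submodule R M) =
        J ^ (s + 2) • ⊤ ⊔ r • ((J ⊔ Ideal.span {r}) ^ (s + 1) • ⊤ : Submodule R M) := by
      rw [← Submodule.add_eq_sup, add_pow_succ_eq, Submodule.add_eq_sup, Submodule.sup_smul,
        mul_smul, Submodule.ideal_span_singleton_smul]
    have pascal : (s + 1 + (n + 1)).choose (n + 1) =
        (s + (n + 1)).choose (n + 1) + (s + 1 + n).choose n := by
      rw [← add_assoc, Nat.choose_succ_succ', add_comm, add_right_comm s 1 n, add_assoc s n 1]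
    rw [pow_succ_smul_top, pascal]
    exact sup_smul ((hJ (s + 1)).isSMulRegular hr) (Submodule.smul_mono_left pow_le) ih
      (quotient_sup_smul_top (s + 1))

theorem isIteratedExtension_quotient_ofList_pow {rs : List R} (hrs : IsWeaklyRegular M rs) (s : ℕ) :
    IsIteratedExtension R (M ⧸ (Ideal.ofList rs • ⊤ : Submodule R M))
      (M ⧸ (Ideal.ofList rs ^ (s + 1) • ⊤ : Submodule R M))
      ((s + rs.length).choose rs.length) := by
  induction rs using List.reverseRecOn generalizing s with
  | nil =>
    rw [List.length_nil, Nat.choose_zero_right, Ideal.ofList_nil, Ideal.bot_pow s.succ_ne_zero]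
    exact .of_equiv (LinearEquiv.refl R _)
  | append_singleton rs r ih =>
    obtain ⟨hrs, hr⟩ := (isWeaklyRegular_append_iff M rs [r]).mp hrs
    rw [isWeaklyRegular_singleton_iff] at hr
    rw [Ideal.ofList_append, Ideal.ofList_singleton, List.length_append, List.length_singleton]
    exact .quotient_sup_span_singleton_pow hr (ih hrs) s

theorem length_quotient_ofList_pow {rs : List R} (hrs : IsWeaklyRegular R rs) (s : ℕ) :
    Module.length R (R ⧸ Ideal.ofList rs ^ (s + 1)) =
      (s + rs.length).choose rs.length * Module.length R (R ⧸ Ideal.ofList rs) := by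
  have length_eq := (isIteratedExtension_quotient_ofList_pow hrs s).length_eq
  rwa [smul_eq_mul, Ideal.mul_top, smul_eq_mul, Ideal.mul_top] at length_eq

end IteratedExtension

section GradedIdeal

open MvPolynomial

attribute [local instance] MvPolynomial.gradedAlgebra

variable {σ R : Type*} [CommRing R] {I : Ideal (MvPolynomial σ R)} {f : MvPolynomial σ R} {d : ℕ}

lemma homogeneousComponent_mul_of_isHomogeneous (hf : f.IsHomogeneous d) (p : MvPolynomial σ R)
    (m : ℕ) : homogeneousComponent m (f * p) =
      if d ≤ m then f * homogeneousComponent (m - d) p else 0 := by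
  have decompose_mul :=
    DirectSum.coe_decompose_mul_of_left_mem (homogeneousSubmodule σ R) (b := p) m hf
  simpa only [← decomposition.decompose'_apply] using! decompose_mul

lemma mem_sup_idealOfVars_pow_iff (hI : I.IsHomogeneous (homogeneousSubmodule σ R)) {s : ℕ}
    {p : MvPolynomial σ R} :
    p ∈ I ⊔ idealOfVars σ R ^ s ↔ ∀ m < s, homogeneousComponent m p ∈ I := by
  constructor
  · intro hp m hm
    obtain ⟨q, hq, r, hr, rfl⟩ := Submodule.mem_sup.mp hp
    have component_eq_zero : homogeneousComponent m r = 0 :=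
      homogeneousComponent_eq_zero' m r fun u hu =>
        (hm.trans_le ((mem_pow_idealOfVars_iff s r).mp hr u hu)).ne'
    rw [map_add, component_eq_zero, add_zero]
    exact homogeneousComponent_mem_of_mem hI hq m
  · intro hp
    rw [← sum_homogeneousComponent p]
    refine sum_mem fun m _ => ?_
    rcases lt_or_ge m s with hm | hm
    · exact Submodule.mem_sup_left (hp m hm)
    · refine Submodule.mem_sup_right ((mem_pow_idealOfVars_iff s _).mpr fun u hu => hm.trans_eq ?_)
      exact ((homogeneousComponent_isHomogeneous m p).degree_eq_sum_deg_support hu)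

lemma isHomogeneous_span_range {ι : Type*}
    {f : ι → MvPolynomial σ R} {d : ι → ℕ}
    (hdeg : ∀ i, (f i).IsHomogeneous (d i)) :
    (Ideal.span (Set.range f)).IsHomogeneous (homogeneousSubmodule σ R) :=
  Ideal.homogeneous_span _ _ <| Set.forall_mem_range.mpr fun i => ⟨d i, hdeg i⟩

lemma iInf_sup_idealOfVars_pow (hI : I.IsHomogeneous (homogeneousSubmodule σ R)) :
    ⨅ s, I ⊔ idealOfVars σ R ^ s = I := by
  refine le_antisymm (fun p hp => ?_) (le_iInf fun _ => le_sup_left)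
  refine (mem_iff_homogeneousComponent_mem hI p).mpr fun m => ?_
  exact (mem_sup_idealOfVars_pow_iff hI).mp (Submodule.mem_iInf _ |>.mp hp (m + 1)) m m.lt_succ_self

lemma comap_lsmul_sup_idealOfVars_pow (hI : I.IsHomogeneous (homogeneousSubmodule σ R))
    (hf : f.IsHomogeneous d) (hreg : IsSMulRegular (MvPolynomial σ R ⧸ I) f) (s : ℕ) :
    Submodule.comap (LinearMap.lsmul (MvPolynomial σ R) (MvPolynomial σ R) f)
      (I ⊔ idealOfVars σ R ^ s) = I ⊔ idealOfVars σ R ^ (s - d) := by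
  have mul_mem_iff (q : MvPolynomial σ R) : f * q ∈ I ↔ q ∈ I :=
    ⟨mem_of_isSMulRegular_quotient_of_smul_mem hreg, I.mul_mem_left f⟩
  ext p
  rw [Submodule.mem_comap, LinearMap.lsmul_apply, smul_eq_mul, mem_sup_idealOfVars_pow_iff hI,
    mem_sup_idealOfVars_pow_iff hI]
  simp only [homogeneousComponent_mul_of_isHomogeneous hf]
  constructor
  · intro hp m hm
    have shift_mem := hp (m + d) (by omega)
    rwa [if_pos (Nat.le_add_left d m), Nat.add_sub_cancel, mul_mem_iff] at shift_mem
  · intro hp m hm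
    split_ifs with hdm
    · exact (mul_mem_iff _).mpr (hp (m - d) (by omega))
    · exact I.zero_mem

end GradedIdeal

section Variables

open MvPolynomial

variable {σ R : Type*} [CommRing R]

lemma isSMulRegular_quotient_span_X_image {s : Set σ} {i : σ} (hi : i ∉ s) :
    IsSMulRegular (MvPolynomial σ R ⧸ Ideal.span (X '' s : Set (MvPolynomial σ R)))
      (X i : MvPolynomial σ R) := by
  refine (isSMulRegular_quotient_iff_mem_of_smul_mem _ _).mpr fun p hp => ?_
  rw [mem_ideal_span_X_image] at hp ⊢
  intro u hu
  have shift_mem : Finsupp.single i 1 + u ∈ ((X i : MvPolynomial σ R) • p).support := by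
    rwa [smul_eq_mul, mem_support_iff, coeff_X_mul, ← mem_support_iff]
  obtain ⟨j, hj, hj'⟩ := hp _ shift_mem
  have hij : i ≠ j := by rintro rfl; exact hi hj
  exact ⟨j, hj, by simpa [hij] using hj'⟩

lemma isWeaklyRegular_map_X {l : List σ} (hl : l.Nodup) :
    IsWeaklyRegular (MvPolynomial σ R) (l.map (X : σ → MvPolynomial σ R)) := by
  induction l using List.reverseRecOn with
  | nil => exact .nil _ _
  | append_singleton l i ih =>
    obtain ⟨hl, hi⟩ : l.Nodup ∧ i ∉ l := by
      rwa [← List.concat_eq_append, List.nodup_concat, and_comm] at hl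
    have ofList_eq : Ideal.ofList (l.map X) =
        Ideal.span (X '' {j | j ∈ l} : Set (MvPolynomial σ R)) := by
      rw [Ideal.ofList]
      congr 1
      ext p
      simp
    rw [List.map_append, isWeaklyRegular_append_iff, List.map_singleton,
      isWeaklyRegular_singleton_iff, smul_eq_mul, Ideal.mul_top, ofList_eq]
    exact ⟨ih hl, isSMulRegular_quotient_span_X_image hi⟩

lemma ker_constantCoeff_eq_idealOfVars :
    RingHom.ker (constantCoeff : MvPolynomial σ R →+* R) = idealOfVars σ R := by
  ext p
  rw [RingHom.mem_ker, ← pow_one (idealOfVars σ R), mem_pow_idealOfVars_iff']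
  simp only [constantCoeff_eq, Nat.lt_one_iff, Finsupp.degree_eq_zero_iff, forall_eq]

lemma length_quotient_idealOfVars (σ k : Type*) [Field k] :
    Module.length (MvPolynomial σ k) (MvPolynomial σ k ⧸ idealOfVars σ k) = 1 := by
  rw [Module.length_eq_one_iff, isSimpleModule_iff_isCoatom, ← Ideal.isMaximal_def,
    ← ker_constantCoeff_eq_idealOfVars]
  exact RingHom.ker_isMaximal_of_surjective _ fun a => ⟨C a, constantCoeff_C _ a⟩

end Variables

section HilbertSamuel

open MvPolynomial

open scoped PowerSeries

attribute [local instance] MvPolynomial.gradedAlgebra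

/-- The generating function of the Hilbert–Samuel function of `S / I` at the origin, where
`S` is a polynomial ring over `R` with irrelevant ideal `𝔪 = (x_1, …, x_n)`: its coefficient of
`X ^ s` is the length of `S / (I + 𝔪 ^ (s + 1))`. Infinite lengths are recorded as `0`; none
occur when `R` is a field and there are finitely many variables. -/
noncomputable def hilbertSamuelSeries {σ R : Type*} [CommRing R] (I : Ideal (MvPolynomial σ R)) :
    ℤ⟦X⟧ :=
  PowerSeries.mk fun s => ((Module.length (MvPolynomial σ R)
    (MvPolynomial σ R ⧸ I ⊔ idealOfVars σ R ^ (s + 1))).toNat : ℤ)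

variable {k : Type*} [Field k] {n : ℕ}

lemma length_quotient_idealOfVars_pow (s : ℕ) :
    Module.length (MvPolynomial (Fin n) k)
      (MvPolynomial (Fin n) k ⧸ idealOfVars (Fin n) k ^ (s + 1)) = ((s + n).choose n : ℕ∞) := by
  have ofList_eq : Ideal.ofList ((List.finRange n).map (X : Fin n → MvPolynomial (Fin n) k)) =
      idealOfVars (Fin n) k := by
    rw [← List.ofFn_eq_map, ofList_ofFn]
  have length_eq := length_quotient_ofList_pow
    (isWeaklyRegular_map_X (R := k) (List.nodup_finRange n)) s
  rwa [ofList_eq, length_quotient_idealOfVars, List.length_map, List.length_finRange, mul_one]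
    at length_eq

lemma length_quotient_sup_idealOfVars_pow_ne_top (I : Ideal (MvPolynomial (Fin n) k)) (s : ℕ) :
    Module.length (MvPolynomial (Fin n) k)
      (MvPolynomial (Fin n) k ⧸ I ⊔ idealOfVars (Fin n) k ^ s) ≠ ⊤ := by
  have pow_le : idealOfVars (Fin n) k ^ (s + 1) ≤ I ⊔ idealOfVars (Fin n) k ^ s :=
    (Ideal.pow_le_pow_right s.le_succ).trans le_sup_right
  refine ne_top_of_le_ne_top ?_
    (Module.length_le_of_surjective (Submodule.factor pow_le) (Submodule.factor_surjective _))
  rw [length_quotient_idealOfVars_pow]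
  exact ENat.natCast_ne_top _

lemma hilbertSamuelSeries_bot :
    hilbertSamuelSeries (⊥ : Ideal (MvPolynomial (Fin n) k)) = PowerSeries.mk 1 ^ (n + 1) := by
  rw [PowerSeries.mk_one_pow_eq_mk_choose_add]
  ext s
  rw [hilbertSamuelSeries, PowerSeries.coeff_mk, PowerSeries.coeff_mk, bot_sup_eq,
    length_quotient_idealOfVars_pow, ENat.toNat_natCast, add_comm]

variable {I : Ideal (MvPolynomial (Fin n) k)}

lemma hilbertSamuelSeries_sup_span_singleton {f : MvPolynomial (Fin n) k} {d : ℕ}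
    (hI : I.IsHomogeneous (homogeneousSubmodule (Fin n) k)) (hf : f.IsHomogeneous d)
    (hreg : IsSMulRegular (MvPolynomial (Fin n) k ⧸ I) f) :
    hilbertSamuelSeries (I ⊔ Ideal.span {f}) = (1 - PowerSeries.X ^ d) * hilbertSamuelSeries I := by
  rw [sub_mul, one_mul, eq_sub_iff_add_eq']
  ext s
  have sup_eq : I ⊔ idealOfVars (Fin n) k ^ (s + 1) ⊔ f • ⊤ =
      I ⊔ Ideal.span {f} ⊔ idealOfVars (Fin n) k ^ (s + 1) := by
    rw [← Submodule.ideal_span_singleton_smul, smul_eq_mul, Ideal.mul_top, sup_right_comm]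
  have length_add := length_quotient_eq_length_comap_add_length_sup
    (I ⊔ idealOfVars (Fin n) k ^ (s + 1)) f
  rw [comap_lsmul_sup_idealOfVars_pow hI hf hreg, sup_eq] at length_add
  simp only [hilbertSamuelSeries, map_add, PowerSeries.coeff_X_pow_mul', PowerSeries.coeff_mk]
  rw [length_add, ENat.toNat_add (length_quotient_sup_idealOfVars_pow_ne_top _ _)
    (length_quotient_sup_idealOfVars_pow_ne_top _ _), Nat.cast_add]
  congr 1
  split_ifs with hds
  · rw [Nat.sub_add_comm hds]
  · have : Subsingleton (MvPolynomial (Fin n) k ⧸ I ⊔ idealOfVars (Fin n) k ^ (s + 1 - d)) := by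
      rw [Nat.sub_eq_zero_of_le (by omega), pow_zero, Ideal.one_eq_top, sup_top_eq]
      infer_instance
    rw [Module.length_eq_zero, ENat.toNat_zero, Nat.cast_zero]

lemma hilbertSamuelSeries_span_range {m : ℕ} {f : Fin m → MvPolynomial (Fin n) k} {d : Fin m → ℕ}
    (hdeg : ∀ i, (f i).IsHomogeneous (d i))
    (hreg : IsWeaklyRegular (MvPolynomial (Fin n) k) (List.ofFn f)) :
    hilbertSamuelSeries (Ideal.span (Set.range f)) =
      (∏ i, (1 - PowerSeries.X ^ d i)) * PowerSeries.mk 1 ^ (n + 1) := by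
  induction m with
  | zero =>
    rw [Set.range_eq_empty, Ideal.span_empty, hilbertSamuelSeries_bot, Fin.prod_univ_zero, one_mul]
  | succ m ih =>
    rw [List.ofFn_succ', List.concat_eq_append, isWeaklyRegular_append_iff,
      isWeaklyRegular_singleton_iff, smul_eq_mul, Ideal.mul_top, ofList_ofFn] at hreg
    obtain ⟨hreg_init, hreg_last⟩ := hreg
    have span_eq : Ideal.span (Set.range f) =
        Ideal.span (Set.range fun i : Fin m => f i.castSucc) ⊔ Ideal.span {f (Fin.last m)} := by
      rw [← ofList_ofFn, List.ofFn_succ', List.concat_eq_append, Ideal.ofList_append,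
        Ideal.ofList_singleton, ofList_ofFn]
    have isHomogeneous_init := isHomogeneous_span_range fun i : Fin m => hdeg i.castSucc
    have series_init := ih (fun i => hdeg i.castSucc) hreg_init
    rw [span_eq, hilbertSamuelSeries_sup_span_singleton isHomogeneous_init (hdeg _) hreg_last,
      series_init, Fin.prod_univ_castSucc]
    ring

lemma one_sub_X_pow_mul_mk_one (d : ℕ) :
    (1 - PowerSeries.X ^ d) * PowerSeries.mk 1 =
      ((∑ j ∈ Finset.range d, Polynomial.X ^ j : Polynomial ℤ) : ℤ⟦X⟧) := by
  rw [← Polynomial.coe_X, ← Polynomial.coe_one, ← Polynomial.coe_pow, ← Polynomial.coe_sub,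
    ← geom_sum_mul_neg, Polynomial.coe_mul, Polynomial.coe_sub, Polynomial.coe_X,
    Polynomial.coe_one, mul_assoc, mul_comm (1 - _), PowerSeries.mk_one_mul_one_sub_eq_one, mul_one]

lemma prod_one_sub_X_pow_mul_mk_one_pow (d : Fin n → ℕ) :
    (∏ i, (1 - PowerSeries.X ^ d i)) * PowerSeries.mk 1 ^ (n + 1) =
      ((∏ i, ∑ j ∈ Finset.range (d i), Polynomial.X ^ j : Polynomial ℤ) : ℤ⟦X⟧) *
        PowerSeries.mk 1 := by
  rw [pow_succ, ← mul_assoc, ← Fin.prod_const, ← Finset.prod_mul_distrib,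
    ← Polynomial.coeToPowerSeries.ringHom_apply, map_prod]
  simp only [one_sub_X_pow_mul_mk_one, Polynomial.coeToPowerSeries.ringHom_apply]

lemma eventually_coeff_mul_mk_one (P : Polynomial ℤ) :
    ∀ᶠ s in Filter.atTop, PowerSeries.coeff s ((P : ℤ⟦X⟧) * PowerSeries.mk 1) = P.eval 1 := by
  filter_upwards [Filter.eventually_ge_atTop P.natDegree] with s hs
  rw [PowerSeries.coeff_mul, Finset.Nat.sum_antidiagonal_eq_sum_range_succ_mk,
    P.eval_eq_sum_range' (Nat.lt_succ_of_le hs)]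
  simp

lemma length_quotient_eq_of_eventually_length_quotient_sup_idealOfVars_pow_eq
    (hI : I.IsHomogeneous (homogeneousSubmodule (Fin n) k)) {l : ℕ∞}
    (hl : ∀ᶠ s in Filter.atTop, Module.length (MvPolynomial (Fin n) k)
      (MvPolynomial (Fin n) k ⧸ I ⊔ idealOfVars (Fin n) k ^ s) = l) :
    Module.length (MvPolynomial (Fin n) k) (MvPolynomial (Fin n) k ⧸ I) = l := by
  obtain ⟨N, length_eq⟩ := Filter.eventually_atTop.mp hl
  have sup_pow_antitone : Antitone fun s => I ⊔ idealOfVars (Fin n) k ^ s :=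
    fun s t hst => sup_le_sup_left (Ideal.pow_le_pow_right hst) I
  have sup_pow_stable (s : ℕ) (hs : N ≤ s) :
      I ⊔ idealOfVars (Fin n) k ^ s = I ⊔ idealOfVars (Fin n) k ^ N :=
    eq_of_le_of_length_quotient_eq (sup_pow_antitone hs)
      ((length_eq s hs).trans (length_eq N le_rfl).symm)
      (length_quotient_sup_idealOfVars_pow_ne_top I N)
  have le_sup_pow (s : ℕ) : I ⊔ idealOfVars (Fin n) k ^ N ≤ I ⊔ idealOfVars (Fin n) k ^ s :=
    (sup_pow_stable _ (le_max_left N s)).ge.trans (sup_pow_antitone (le_max_right N s))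
  have sup_pow_eq : I ⊔ idealOfVars (Fin n) k ^ N = I :=
    le_antisymm ((le_iInf le_sup_pow).trans_eq (iInf_sup_idealOfVars_pow hI)) le_sup_left
  rw [← length_eq N le_rfl, sup_pow_eq]

theorem length_quotient_span_range {f : Fin n → MvPolynomial (Fin n) k} {d : Fin n → ℕ}
    (hdeg : ∀ i, (f i).IsHomogeneous (d i))
    (hreg : IsWeaklyRegular (MvPolynomial (Fin n) k) (List.ofFn f)) :
    Module.length (MvPolynomial (Fin n) k)
      (MvPolynomial (Fin n) k ⧸ Ideal.span (Set.range f)) = (∏ i, d i : ℕ) := by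
  have series_eq := hilbertSamuelSeries_span_range hdeg hreg
  rw [prod_one_sub_X_pow_mul_mk_one_pow] at series_eq
  refine length_quotient_eq_of_eventually_length_quotient_sup_idealOfVars_pow_eq
    (isHomogeneous_span_range hdeg) ?_
  rw [← Filter.map_add_atTop_eq_nat 1, Filter.eventually_map]
  filter_upwards [eventually_coeff_mul_mk_one _] with s hs
  rw [← series_eq, hilbertSamuelSeries, PowerSeries.coeff_mk, Polynomial.eval_prod] at hs
  simp only [Polynomial.eval_geom_sum, one_pow, Finset.sum_const, Finset.card_range,
    nsmul_eq_mul, mul_one] at hs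
  rw [← ENat.natCast_toNat (length_quotient_sup_idealOfVars_pow_ne_top _ (s + 1))]
  exact_mod_cast hs

end HilbertSamuel

section Uniqueness

lemma linearIndependent_preHilbertPoly (F : Type*) [Field F] [CharZero F] (c : ℕ) :
    LinearIndependent F fun j => Polynomial.preHilbertPoly F j c := by
  have ne_zero (j : ℕ) : Polynomial.preHilbertPoly F j c ≠ 0 := by
    rw [← Polynomial.leadingCoeff_ne_zero, Polynomial.leadingCoeff_preHilbertPoly]
    exact inv_ne_zero (Nat.cast_ne_zero.mpr j.factorial_ne_zero)
  exact Polynomial.Sequence.linearIndependent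
    ⟨fun j => Polynomial.preHilbertPoly F j c, fun j => by
      rw [Polynomial.degree_eq_natDegree (ne_zero j), Polynomial.natDegree_preHilbertPoly]⟩

lemma eq_zero_of_eventually_eval_natCast_eq_zero {F : Type*} [Field F] [CharZero F]
    {P : Polynomial F} (hP : ∀ᶠ s : ℕ in Filter.atTop, P.eval (s : F) = 0) : P = 0 := by
  have infinite : {s : ℕ | P.eval (s : F) = 0}.Infinite :=
    Nat.frequently_atTop_iff_infinite.mp hP.frequently
  refine P.eq_zero_of_infinite_isRoot ((infinite.image Nat.cast_injective.injOn).mono ?_)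
  rintro _ ⟨s, hs, rfl⟩
  exact hs

lemma eq_zero_of_eventually_sum_mul_choose_eq_zero {F : Type*} [Field F] [CharZero F] {n : ℕ}
    {a : Fin (n + 1) → F} (ha : ∀ᶠ s : ℕ in Filter.atTop, ∑ i : Fin (n + 1),
      a i * ((s + (n - (i : ℕ)) - 1).choose (n - (i : ℕ)) : F) = 0) : a = 0 := by
  have sum_smul_eq_zero :
      ∑ i : Fin (n + 1), a i • Polynomial.preHilbertPoly F (n - (i : ℕ)) 1 = 0 := by
    refine eq_zero_of_eventually_eval_natCast_eq_zero ?_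
    filter_upwards [ha, Filter.eventually_ge_atTop 1] with s hs one_le
    simp only [Polynomial.eval_finsetSum, Polynomial.eval_smul, smul_eq_mul,
      Polynomial.preHilbertPoly_eq_choose_sub_add F _ one_le, ← Nat.sub_add_comm one_le, hs]
  have sub_injective : Function.Injective fun i : Fin (n + 1) => n - (i : ℕ) :=
    fun i j (hij : n - (i : ℕ) = n - (j : ℕ)) => Fin.ext (by omega)
  exact funext <| Fintype.linearIndependent_iff.mp
    ((linearIndependent_preHilbertPoly F 1).comp _ sub_injective) a sum_smul_eq_zero

lemma IsHilbertCoefficients.unique {k : Type*} [Field k] {n : ℕ}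
    {I : Ideal (MvPolynomial (Fin n) k)} {e e' : Fin (n + 1) → ℚ}
    (he : IsHilbertCoefficients I e) (he' : IsHilbertCoefficients I e') : e = e' := by
  suffices h : (fun i : Fin (n + 1) => (-1 : ℚ) ^ (i : ℕ) * (e i - e' i)) = 0 from
    funext fun i => by simpa [sub_eq_zero] using congrFun h i
  refine eq_zero_of_eventually_sum_mul_choose_eq_zero ?_
  filter_upwards [he, he'] with s ⟨l, hl, hsum⟩ ⟨l', hl', hsum'⟩
  obtain rfl : l = l' := by exact_mod_cast hl.symm.trans hl'
  simp only [mul_sub, sub_mul, Finset.sum_sub_distrib, ← hsum, ← hsum', sub_self]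

end Uniqueness

theorem mainTheorem5 {k : Type*} [Field k] (n : ℕ)
    (f : Fin n → MvPolynomial (Fin n) k) (d : Fin n → ℕ)
    (hdeg : ∀ i, (f i).IsHomogeneous (d i))
    (hreg : RingTheory.Sequence.IsRegular (MvPolynomial (Fin n) k) (List.ofFn f)) :
    (∃! e : Fin (n + 1) → ℚ, IsHilbertCoefficients (Ideal.span (Set.range f)) e) ∧
    ∀ e : Fin (n + 1) → ℚ, IsHilbertCoefficients (Ideal.span (Set.range f)) e →
      e 0 = ∏ i, (d i : ℚ) ∧ ∀ i : Fin (n + 1), 0 < i → e i = 0 := by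
  have isHilbertCoefficients_single : IsHilbertCoefficients (Ideal.span (Set.range f))
      (Pi.single 0 (∏ i, (d i : ℚ))) := by
    filter_upwards [Filter.eventually_ge_atTop 1] with s one_le
    have length_pow := length_quotient_ofList_pow hreg.toIsWeaklyRegular (s - 1)
    rw [ofList_ofFn, length_quotient_span_range hdeg hreg.toIsWeaklyRegular, List.length_ofFn,
      Nat.sub_add_cancel one_le, ← Nat.sub_add_comm one_le] at length_pow
    refine ⟨(s + n - 1).choose n * ∏ i, d i, by exact_mod_cast length_pow, ?_⟩
    rw [Finset.sum_eq_single 0 (fun i _ hi => by rw [Pi.single_eq_of_ne hi, mul_zero, zero_mul])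
      (fun h => absurd (Finset.mem_univ 0) h)]
    simp [mul_comm]
  refine ⟨⟨_, isHilbertCoefficients_single, fun e he => he.unique isHilbertCoefficients_single⟩,
    fun e he => ?_⟩
  rw [he.unique isHilbertCoefficients_single]
  exact ⟨Pi.single_eq_same _ _, fun i hi => Pi.single_eq_of_ne hi.ne' _⟩
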